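/- There is an absolute constant $N$ with the following property. Let $F$ be any field (of any characteristic), let $f \in F[x_0,x_1,x_2]$ be a nonzero homogeneous polynomial of degree $D>0$, and let $\Gamma \subset \mathbb{P}^2_F$ be the (possibly non-reduced or reducible) plane curve $f=0$. For a rational point $P \in \Gamma(F)$, let $\operatorname{mult}_P(\Gamma)$ be the multiplicity of $\Gamma$ at $P$: if $f(x)=\sum_{m\ge 0} f_m(x)$ is the expansion of a local equation of $\Gamma$ in local coordinates $x=(x_1,x_2)$ of $\mathbb{P}^2_F$ centred at $P$, with $f_m$ homogeneous of degree $m$, then $\operatorname{mult}_P(\Gamma)$ is the smallest $m$ with $f_m \neq 0$. Then for every real number $k\ge 1$ there is a nonzero homogeneous polynomial $g\in F[x_0,x_1,x_2]$ of some degree $e$ with $1\le e\le N k$ such that every point $P\in\Gamma(F)$ with $\operatorname{mult}_P(\Gamma)\ge D/k$ lies on the plane curve $g=0$. -/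

import Mathlib

open scoped LinearAlgebra.Projectivization

namespace PlaneCurve

/-- The set of `F`-rational points of the plane projective curve `f = 0`, for `f` a homogeneous
polynomial; it does not depend on the chosen representatives (see `mk_mem_points_iff`). -/
def points {F : Type*} [Field F] (f : MvPolynomial (Fin 3) F) : Set (ℙ F (Fin 3 → F)) :=
  {P | MvPolynomial.eval P.rep f = 0}

/-- The local equation of the curve `f = 0` at the point `(v 0 : v 1 : v 2)` with `v i ≠ 0`, in the
affine chart `xᵢ ≠ 0`, in the local coordinates `xⱼ / xᵢ - vⱼ / vᵢ` (`j ≠ i`), which vanish at the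
point: the variable `xᵢ` is replaced by `1` and `xⱼ` by `xⱼ + vⱼ / vᵢ`. -/
noncomputable def localEquation {F : Type*} [Field F] (f : MvPolynomial (Fin 3) F)
    (v : Fin 3 → F) (i : Fin 3) : MvPolynomial {j : Fin 3 // j ≠ i} F :=
  MvPolynomial.aeval
    (fun j => if h : j = i then 1 else MvPolynomial.X ⟨j, h⟩ + MvPolynomial.C (v j / v i)) f

/-- The smallest `m` such that the homogeneous part of degree `m` of `p` is nonzero
(for `p ≠ 0`). -/
noncomputable def orderAtOrigin {F σ : Type*} [Field F] (p : MvPolynomial σ F) : ℕ :=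
  sInf {m : ℕ | MvPolynomial.homogeneousComponent m p ≠ 0}

theorem exists_rep_ne_zero {F : Type*} [Field F] (P : ℙ F (Fin 3 → F)) : ∃ i, P.rep i ≠ 0 :=
  Function.ne_iff.mp P.rep_nonzero

/-- The multiplicity at the rational point `P` of the curve `f = 0` (`f ≠ 0` homogeneous), computed
in some standard affine chart containing `P`; neither the chart nor the representative matters
(see `multiplicity_mk`). -/
noncomputable def multiplicity {F : Type*} [Field F] (f : MvPolynomial (Fin 3) F)
    (P : ℙ F (Fin 3 → F)) : ℕ :=
  orderAtOrigin (localEquation f P.rep (exists_rep_ne_zero P).choose)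

theorem eval_smul_eq_zero_iff {F : Type*} [Field F] {f : MvPolynomial (Fin 3) F} {D : ℕ}
    (hf : f.IsHomogeneous D) {c : F} (hc : c ≠ 0) (v : Fin 3 → F) :
    MvPolynomial.eval (c • v) f = 0 ↔ MvPolynomial.eval v f = 0 := by
  have h : MvPolynomial.eval (c • v) f = c ^ D * MvPolynomial.eval v f := by
    rw [MvPolynomial.eval_eq, MvPolynomial.eval_eq, Finset.mul_sum]
    refine Finset.sum_congr rfl fun d hd => ?_
    have hdeg : ∑ i ∈ d.support, d i = D := by
      have := hf (MvPolynomial.mem_support_iff.mp hd)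
      rwa [show Finsupp.weight (1 : Fin 3 → ℕ) d = d.degree from
        (DFunLike.congr_fun Finsupp.degree_eq_weight_one d).symm, Finsupp.degree_apply] at this
    simp only [Pi.smul_apply, smul_eq_mul, mul_pow, Finset.prod_mul_distrib,
      Finset.prod_pow_eq_pow_sum, hdeg]
    ring
  simp [h, hc]

theorem mk_mem_points_iff {F : Type*} [Field F] {f : MvPolynomial (Fin 3) F} {D : ℕ}
    (hf : f.IsHomogeneous D) (v : Fin 3 → F) (hv : v ≠ 0) :
    Projectivization.mk F v hv ∈ points f ↔ MvPolynomial.eval v f = 0 := by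
  obtain ⟨c, hc⟩ := Projectivization.exists_smul_eq_mk_rep F v hv
  have hc' : c • v = (c : F) • v := rfl
  rw [points, Set.mem_ofPred_eq, ← hc, hc', eval_smul_eq_zero_iff hf c.ne_zero]

theorem localEquation_smul {F : Type*} [Field F] (f : MvPolynomial (Fin 3) F) {c : F} (hc : c ≠ 0)
    (v : Fin 3 → F) (i : Fin 3) : localEquation f (c • v) i = localEquation f v i := by
  simp only [localEquation, Pi.smul_apply, smul_eq_mul, mul_div_mul_left _ _ hc]

/-- The ideal of the point `(v 0 : v 1 : v 2)`. -/
noncomputable def pointIdeal {F : Type*} [Field F] (v : Fin 3 → F) : Ideal (MvPolynomial (Fin 3) F) :=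
  Ideal.span (Set.range fun a : Fin 3 × Fin 3 =>
    MvPolynomial.C (v a.1) * MvPolynomial.X a.2 - MvPolynomial.C (v a.2) * MvPolynomial.X a.1)

open MvPolynomial in
theorem localEquation_mem_of_mem {F : Type*} [Field F] {f : MvPolynomial (Fin 3) F}
    {v : Fin 3 → F} {i : Fin 3} (hi : v i ≠ 0) {n : ℕ} (h : f ∈ pointIdeal v ^ n) :
    localEquation f v i ∈ idealOfVars {j : Fin 3 // j ≠ i} F ^ n := by
  set e : MvPolynomial (Fin 3) F →ₐ[F] MvPolynomial {j : Fin 3 // j ≠ i} F :=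
    aeval (fun j => if h : j = i then 1 else X ⟨j, h⟩ + C (v j / v i)) with he
  have hle : (pointIdeal v).map e ≤ idealOfVars {j : Fin 3 // j ≠ i} F := by
    rw [pointIdeal, Ideal.map_span, Ideal.span_le]
    -- modulo the variables, `xⱼ` becomes `vⱼ / vᵢ` for all `j`
    have key : ∀ j, e (X j) - C (v j / v i) ∈ idealOfVars {j : Fin 3 // j ≠ i} F := by
      intro j
      by_cases hj : j = i
      · subst hj
        simp [he, hi]
      · simp only [he, aeval_X, dif_neg hj, add_sub_cancel_right]
        exact Ideal.subset_span ⟨_, rfl⟩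
    rintro _ ⟨_, ⟨⟨a, b⟩, rfl⟩, rfl⟩
    have hab : (C (v a) * C (v b / v i) : MvPolynomial {j : Fin 3 // j ≠ i} F)
        = C (v b) * C (v a / v i) := by
      rw [← C_mul, ← C_mul]; congr 1; ring
    have hC : ∀ x : F, e (C x) = C x := fun x => e.commutes x
    have : e (C (v a) * X b - C (v b) * X a)
        = C (v a) * (e (X b) - C (v b / v i)) - C (v b) * (e (X a) - C (v a / v i)) := by
      rw [map_sub, map_mul, map_mul, hC, hC]
      linear_combination hab
    exact this ▸ sub_mem (Ideal.mul_mem_left _ _ (key b)) (Ideal.mul_mem_left _ _ (key a))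
  have := Ideal.mem_map_of_mem e h
  rw [Ideal.map_pow] at this
  exact Ideal.pow_right_mono hle n this

open MvPolynomial in
theorem mem_of_localEquation_mem {F : Type*} [Field F] {f : MvPolynomial (Fin 3) F} {D : ℕ}
    (hf : f.IsHomogeneous D) {v : Fin 3 → F} {i : Fin 3} (hi : v i ≠ 0) {n : ℕ}
    (h : localEquation f v i ∈ idealOfVars {j : Fin 3 // j ≠ i} F ^ n) :
    f ∈ pointIdeal v ^ n := by
  -- a linear change of coordinates moving the point to a coordinate point, and its inverse
  set l : Fin 3 → MvPolynomial (Fin 3) F :=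
    fun j => if j = i then X i else X j + C (v j / v i) * X i with hl
  set l' : Fin 3 → MvPolynomial (Fin 3) F :=
    fun j => if j = i then X i else X j - C (v j / v i) * X i with hl'
  set g := aeval l f with hg
  have hgf : aeval l' g = f := by
    have : (aeval l').comp (aeval l) = AlgHom.id F (MvPolynomial (Fin 3) F) := by
      apply MvPolynomial.algHom_ext
      intro j
      by_cases hj : j = i
      · simp [hl, hl', hj]
      · simp [hl, hl', hj, ← algebraMap_eq]
    exact congrArg (fun φ => φ f) this
  have hgD : g.IsHomogeneous D := by
    have := hf.aeval l (n := 1) (fun j => by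
      by_cases hj : j = i
      · simpa [hl, hj] using isHomogeneous_X F i
      · simp only [hl, if_neg hj]
        exact (isHomogeneous_X F j).add
          (by simpa using (isHomogeneous_C _ (v j / v i)).mul (isHomogeneous_X F i)))
    rwa [one_mul] at this
  set s : (Fin 3 →₀ ℕ) → ({j : Fin 3 // j ≠ i} →₀ ℕ) := Finsupp.subtypeDomain (· ≠ i) with hs
  have hdeg : ∀ β : Fin 3 →₀ ℕ, β.degree = β i + (s β).degree := by
    intro β
    rw [Finsupp.degree_eq_sum, Finsupp.degree_eq_sum, ← Fintype.sum_subtype_add_sum_subtype (· = i)]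
    congr 1
    have : ∀ x : {j // j = i}, β x = β i := fun x => congrArg β x.2
    simp [this]
  have hloc : localEquation f v i = ∑ β ∈ g.support, monomial (s β) (coeff β g) := by
    have h1 : localEquation f v i
        = aeval (fun j => if h : j = i then (1 : MvPolynomial {j : Fin 3 // j ≠ i} F)
            else X ⟨j, h⟩) g := by
      rw [hg, localEquation, ← AlgHom.comp_apply]
      congr 1
      apply MvPolynomial.algHom_ext
      intro j
      by_cases hj : j = i
      · simp [hl, hj]
      · simp only [hl, aeval_X, AlgHom.comp_apply, dif_neg hj, if_neg hj, map_add, map_mul,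
          dite_true, mul_one, algHom_C, algebraMap_eq]
    rw [h1, aeval_def, eval₂_eq']
    refine Finset.sum_congr rfl fun β _ => ?_
    rw [monomial_eq, algebraMap_eq, Finsupp.prod_fintype _ _ (by simp)]
    congr 1
    rw [← Fintype.prod_subtype_mul_prod_subtype (· = i)]
    rw [Finset.prod_eq_one (fun (x : {j // j = i}) _ => by rw [dif_pos x.2, one_pow]), one_mul]
    exact Finset.prod_congr rfl fun x _ => by rw [dif_neg x.2]; rfl
  have hsupp : ∀ β ∈ g.support, n ≤ (s β).degree := by
    intro β hβ
    by_contra hlt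
    have h0 := (mem_pow_idealOfVars_iff' n _).mp h (s β) (not_le.mp hlt)
    rw [hloc, coeff_sum, Finset.sum_eq_single β] at h0
    · simp only [coeff_monomial, if_true] at h0
      exact (mem_support_iff.mp hβ) h0
    · intro γ hγ hne
      rw [coeff_monomial, if_neg]
      intro hsγ
      apply hne
      have d1 := hgD (mem_support_iff.mp hγ)
      have d2 := hgD (mem_support_iff.mp hβ)
      have hw : ∀ d, Finsupp.weight (1 : Fin 3 → ℕ) d = d.degree := fun d =>
        (DFunLike.congr_fun Finsupp.degree_eq_weight_one d).symm
      rw [hw, hdeg] at d1 d2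
      ext j
      by_cases hj : j = i
      · subst hj
        rw [hsγ] at d1; omega
      · exact DFunLike.congr_fun hsγ ⟨j, hj⟩
    · intro hn; exact absurd hβ hn
  rw [← hgf, aeval_def, eval₂_eq']
  refine Ideal.sum_mem _ fun β hβ => Ideal.mul_mem_left _ _ ?_
  have hmem : ∀ j, j ≠ i → l' j ∈ pointIdeal v := by
    intro j hj
    have : l' j = C (v i)⁻¹ * (C (v i) * X j - C (v j) * X i) := by
      simp only [hl', if_neg hj]
      have e1 : (C (v i)⁻¹ * C (v i) : MvPolynomial (Fin 3) F) = 1 := by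
        rw [← C_mul, inv_mul_cancel₀ hi, C_1]
      have e2 : (C (v j / v i) : MvPolynomial (Fin 3) F) = C (v i)⁻¹ * C (v j) := by
        rw [← C_mul]; congr 1; ring
      rw [e2]
      linear_combination (-X j) * e1
    rw [this]
    exact Ideal.mul_mem_left _ _ (Ideal.subset_span ⟨(i, j), rfl⟩)
  rw [← Fintype.prod_subtype_mul_prod_subtype (· = i)]
  refine Ideal.mul_mem_left _ _ (Ideal.pow_le_pow_right (hsupp β hβ) ?_)
  rw [Finsupp.degree_eq_sum, ← Finset.prod_pow_eq_pow_sum]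
  exact Ideal.prod_mem_prod fun x _ => Ideal.pow_mem_pow (hmem x x.2) _

theorem le_orderAtOrigin_iff {F σ : Type*} [Field F] (p : MvPolynomial σ F) (hp : p ≠ 0) (n : ℕ) :
    n ≤ orderAtOrigin p ↔ p ∈ MvPolynomial.idealOfVars σ F ^ n := by
  have hne : {m : ℕ | MvPolynomial.homogeneousComponent m p ≠ 0}.Nonempty := by
    by_contra hemp
    apply hp
    rw [← MvPolynomial.sum_homogeneousComponent p]
    refine Finset.sum_eq_zero fun m _ => ?_
    by_contra hm
    exact hemp ⟨m, hm⟩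
  rw [MvPolynomial.mem_pow_idealOfVars_iff, orderAtOrigin, le_csInf_iff (OrderBot.bddBelow _) hne]
  constructor
  · intro h d hd
    refine h _ fun h0 => (MvPolynomial.mem_support_iff.mp hd) ?_
    have := congrArg (MvPolynomial.coeff d) h0
    simpa [MvPolynomial.coeff_homogeneousComponent] using this
  · intro h m hm
    obtain ⟨d, hd⟩ := MvPolynomial.ne_zero_iff.mp hm
    rw [MvPolynomial.coeff_homogeneousComponent] at hd
    split_ifs at hd with hdm
    · exact hdm ▸ h d (MvPolynomial.mem_support_iff.mpr hd)
    · exact absurd rfl hd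

/-- The order of the local equation depends neither on the representative nor on the chart. -/
theorem orderAtOrigin_localEquation_eq {F : Type*} [Field F] {f : MvPolynomial (Fin 3) F} {D : ℕ}
    (hf : f.IsHomogeneous D) (v : Fin 3 → F) {i j : Fin 3} (hi : v i ≠ 0) (hj : v j ≠ 0) :
    orderAtOrigin (localEquation f v i) = orderAtOrigin (localEquation f v j) := by
  have key : ∀ {i j : Fin 3}, v i ≠ 0 → v j ≠ 0 → ∀ n,
      localEquation f v i ∈ MvPolynomial.idealOfVars {a : Fin 3 // a ≠ i} F ^ n →
      localEquation f v j ∈ MvPolynomial.idealOfVars {a : Fin 3 // a ≠ j} F ^ n :=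
    fun hi hj n h => localEquation_mem_of_mem hj (mem_of_localEquation_mem hf hi h)
  have zero : ∀ {i j : Fin 3}, v i ≠ 0 → v j ≠ 0 →
      localEquation f v i = 0 → localEquation f v j = 0 := by
    intro i j hi hj h
    by_contra hne
    have := (le_orderAtOrigin_iff _ hne (orderAtOrigin (localEquation f v j) + 1)).mpr
      (key hi hj _ (h ▸ zero_mem _))
    omega
  by_cases h0 : localEquation f v i = 0
  · rw [h0, zero hi hj h0]; simp [orderAtOrigin]
  · have h1 : localEquation f v j ≠ 0 := fun h => h0 (zero hj hi h)
    refine eq_of_forall_le_iff fun n => ?_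
    rw [le_orderAtOrigin_iff _ h0, le_orderAtOrigin_iff _ h1]
    exact ⟨key hi hj n, key hj hi n⟩

theorem multiplicity_mk {F : Type*} [Field F] {f : MvPolynomial (Fin 3) F} {D : ℕ}
    (hf : f.IsHomogeneous D) (v : Fin 3 → F) (hv : v ≠ 0) {i : Fin 3} (hi : v i ≠ 0) :
    multiplicity f (Projectivization.mk F v hv) = orderAtOrigin (localEquation f v i) := by
  obtain ⟨c, hc⟩ := Projectivization.exists_smul_eq_mk_rep F v hv
  have hc' : (c : F) • v = (Projectivization.mk F v hv).rep := hc
  have hi' : (Projectivization.mk F v hv).rep i ≠ 0 := by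
    rw [← hc']; exact mul_ne_zero c.ne_zero hi
  rw [multiplicity, orderAtOrigin_localEquation_eq hf _ (exists_rep_ne_zero _).choose_spec hi',
    ← hc', localEquation_smul f c.ne_zero]

end PlaneCurve

namespace PlaneCurve

open MvPolynomial

/-! Let `m + 1` be the least integer at least `D / k`, and `S` the set of points of multiplicity at
least `m + 1`. If only the zero form of degree `e` vanishes on `S`, then evaluations at `r` points
of `S` form a basis of the dual of the space of these forms, `r` being its dimension; let `q j` be
the dual basis. In a relation `∑ q j ^ (m + 1) * c j + f * c = 0` with each `c j` of degree `m`,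
every term but the `j`-th vanishes to order `m + 1` at the `j`-th point, where `q j` is nonzero. So
`c j` vanishes there to an order above its degree, and is zero; then `c = 0`. Independence gives
about `r * m ^ 2 / 2` dimensions inside the forms of degree `(m + 1) * e + m` modulo `f`, a space of
dimension at most `D` times about that degree. This forces `(m + 1) * (e + 1) < 4 * D`
(`mul_lt_of_forall_eq_zero`), which fails once `e + 1 ≥ 4 * k`. -/

/-- Functionals on a finite-dimensional space with no common zero contain a basis of the dual
space; `q` is the basis dual to it. -/
theorem exists_dual_family {K V S : Type*} [Field K] [AddCommGroup V] [Module K V]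
    [FiniteDimensional K V] {r : ℕ} (hr : Module.finrank K V = r) (φ : S → Module.Dual K V)
    (h : ∀ x, (∀ s, φ s x = 0) → x = 0) :
    ∃ (s : Fin r → S) (q : Fin r → V),
      ∀ i j, φ (s i) (q j) = if i = j then 1 else 0 := by
  have hspan : Submodule.span K (Set.range φ) = ⊤ := by
    have h1 : (Submodule.span K (Set.range φ)).dualCoannihilator = ⊥ := by
      rw [eq_bot_iff]
      intro x hx
      rw [Submodule.mem_dualCoannihilator] at hx
      exact h x fun s => hx _ (Submodule.subset_span ⟨s, rfl⟩)
    rw [← Subspace.dualCoannihilator_dualAnnihilator_eq (W := Submodule.span K (Set.range φ)), h1,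
      Submodule.dualAnnihilator_bot]
  obtain ⟨κ, a, -, hsp, hli⟩ := exists_linearIndependent' K φ
  let b := Module.Basis.mk hli (by rw [hsp, hspan])
  have : Finite κ := Module.Finite.finite_basis b
  have := Fintype.ofFinite κ
  have hcard : Fintype.card κ = r := by
    rw [← hr, ← Module.finrank_eq_card_basis b, Subspace.dual_finrank_eq]
  let c := b.reindex (Fintype.equivFinOfCardEq hcard)
  refine ⟨fun i => a ((Fintype.equivFinOfCardEq hcard).symm i),
    fun j => (Module.evalEquiv K V).symm (c.dualBasis j), fun i j => ?_⟩
  have hc : φ (a ((Fintype.equivFinOfCardEq hcard).symm i)) = c i := by simp [c, b]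
  rw [hc, Module.apply_evalEquiv_symm_apply, Module.Basis.dualBasis_apply_self]

theorem finrank_homogeneousSubmodule (K : Type*) [Field K] (n : ℕ) :
    2 * Module.finrank K (homogeneousSubmodule (Fin 3) K n) = (n + 1) * (n + 2) := by
  have h1 : Module.finrank K (homogeneousSubmodule (Fin 3) K n)
      = Nat.card {d : Fin 3 →₀ ℕ | d.degree = n} := by
    rw [homogeneousSubmodule_eq_finsupp_supported]
    exact Module.finrank_eq_nat_card_basis (basisRestrictSupport K {d : Fin 3 →₀ ℕ | d.degree = n})
  have h2 : {d : Fin 3 →₀ ℕ | d.degree = n}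
      = ((Finset.univ : Finset (Fin 3)).finsuppAntidiag n : Set (Fin 3 →₀ ℕ)) := by
    ext d
    simp [Finsupp.degree_eq_sum, Finset.mem_finsuppAntidiag]
  rw [h1, h2, Nat.card_coe_set_eq, Set.ncard_coe_finset,
    Finset.card_finsuppAntidiag_nat_eq_choose, Finset.card_univ, Fintype.card_fin,
    show 3 + n - 1 = n + 2 by omega, Nat.choose_symm_add, Nat.choose_two_right, mul_comm,
    Nat.div_mul_cancel (Nat.even_mul_pred_self _).two_dvd]
  simp [mul_comm]

instance {K : Type*} [Field K] (n : ℕ) :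
    FiniteDimensional K (homogeneousSubmodule (Fin 3) K n) :=
  Module.Finite.iff_fg.mpr (homogeneousSubmodule_fg (Fin 3) K n)

/-! ### Order of vanishing at a rational point -/

theorem mem_idealOfVars_iff {σ R : Type*} [CommRing R] (p : MvPolynomial σ R) :
    p ∈ idealOfVars σ R ↔ constantCoeff p = 0 := by
  rw [← pow_one (idealOfVars σ R), mem_pow_idealOfVars_iff']
  simp [Finsupp.degree_eq_zero_iff, constantCoeff_eq]

/-- Locally `u` is a unit. Replacing `u` by its constant term changes `u * c` by an element of one
order higher than `c`, so the order of `c` can be raised one step at a time up to `n`. -/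
theorem mem_pow_idealOfVars_of_mul_mem {σ K : Type*} [Field K] {u c : MvPolynomial σ K} {n : ℕ}
    (hu : constantCoeff u ≠ 0) (h : u * c ∈ idealOfVars σ K ^ n) : c ∈ idealOfVars σ K ^ n := by
  suffices ∀ j ≤ n, c ∈ idealOfVars σ K ^ j from this n le_rfl
  intro j
  induction j with
  | zero => simp
  | succ j ih =>
    intro hj
    have h1 : C (constantCoeff u) - u ∈ idealOfVars σ K := by simp [mem_idealOfVars_iff]
    have h2 : C (constantCoeff u) * c ∈ idealOfVars σ K ^ (j + 1) := by
      have : C (constantCoeff u) * c = u * c + (C (constantCoeff u) - u) * c := by ring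
      rw [this, pow_succ']
      exact add_mem (pow_succ' (idealOfVars σ K) j ▸ Ideal.pow_le_pow_right hj h)
        (Ideal.mul_mem_mul h1 (ih (by omega)))
    have h3 := Ideal.mul_mem_left _ (C (constantCoeff u)⁻¹) h2
    rwa [← mul_assoc, ← C_mul, inv_mul_cancel₀ hu, C_1, one_mul] at h3

variable {F : Type*} [Field F]

/-- The constant term is the value of `f` at the representative with `i`-th coordinate `1`. -/
theorem constantCoeff_localEquation_eq_zero_iff {f : MvPolynomial (Fin 3) F} {D : ℕ}
    (hf : f.IsHomogeneous D) {v : Fin 3 → F} {i : Fin 3} (hi : v i ≠ 0) :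
    constantCoeff (localEquation f v i) = 0 ↔ eval v f = 0 := by
  rw [← eval_smul_eq_zero_iff hf (inv_ne_zero hi) v]
  have : (constantCoeff (R := F) (σ := {j : Fin 3 // j ≠ i})).comp
      (aeval (fun j => if h : j = i then 1 else X ⟨j, h⟩ + C (v j / v i)) :
        MvPolynomial (Fin 3) F →ₐ[F] MvPolynomial {j : Fin 3 // j ≠ i} F).toRingHom
      = eval ((v i)⁻¹ • v) := by
    apply ringHom_ext
    · simp
    · intro j
      by_cases hj : j = i
      · subst hj; simp [hi]
      · simp [hj, div_eq_inv_mul]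
  rw [← this]
  rfl

theorem mem_pointIdeal_of_eval_eq_zero {f : MvPolynomial (Fin 3) F} {D : ℕ}
    (hf : f.IsHomogeneous D) {v : Fin 3 → F} (hv : v ≠ 0) (h : eval v f = 0) :
    f ∈ pointIdeal v := by
  obtain ⟨i, hi⟩ := Function.ne_iff.mp hv
  rw [← pow_one (pointIdeal v)]
  refine mem_of_localEquation_mem hf hi ?_
  rwa [pow_one, mem_idealOfVars_iff, constantCoeff_localEquation_eq_zero_iff hf hi]

theorem pointIdeal_le_idealOfVars (v : Fin 3 → F) : pointIdeal v ≤ idealOfVars (Fin 3) F := by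
  rw [pointIdeal, Ideal.span_le]
  rintro _ ⟨a, rfl⟩
  simp [mem_idealOfVars_iff]

/-- The point ideal is generated by linear forms, so its `n`-th power contains no monomials of
degree below `n`. -/
theorem eq_zero_of_mem_pow_pointIdeal {c : MvPolynomial (Fin 3) F} {d n : ℕ}
    (hc : c.IsHomogeneous d) (hd : d < n) {v : Fin 3 → F} (h : c ∈ pointIdeal v ^ n) : c = 0 := by
  have h1 := (mem_pow_idealOfVars_iff n c).mp
    (Ideal.pow_right_mono (pointIdeal_le_idealOfVars v) n h)
  by_contra hne
  obtain ⟨x, hx⟩ := support_nonempty.mpr hne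
  have h2 := h1 x hx
  have h3 := hc (mem_support_iff.mp hx)
  rw [show Finsupp.weight (1 : Fin 3 → ℕ) x = x.degree from
    (DFunLike.congr_fun Finsupp.degree_eq_weight_one x).symm] at h3
  omega

/-- Passing to an affine chart and back reduces this to cancelling a local equation with nonzero
constant term. -/
theorem mem_pow_pointIdeal_of_mul_mem {c u : MvPolynomial (Fin 3) F} {d e n : ℕ}
    (hc : c.IsHomogeneous d) (hu : u.IsHomogeneous e) {v : Fin 3 → F} (hv : v ≠ 0)
    (huv : eval v u ≠ 0) (h : u * c ∈ pointIdeal v ^ n) : c ∈ pointIdeal v ^ n := by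
  obtain ⟨i, hi⟩ := Function.ne_iff.mp hv
  refine mem_of_localEquation_mem hc hi (mem_pow_idealOfVars_of_mul_mem (u := localEquation u v i)
    (mt (constantCoeff_localEquation_eq_zero_iff hu hi).mp huv) ?_)
  have := localEquation_mem_of_mem hi h
  rwa [localEquation, map_mul] at this

theorem mem_pow_pointIdeal_of_le_multiplicity {f : MvPolynomial (Fin 3) F} {D : ℕ}
    (hf : f.IsHomogeneous D) {P : ℙ F (Fin 3 → F)} {m : ℕ} (h : m ≤ multiplicity f P) :
    f ∈ pointIdeal P.rep ^ m := by
  refine mem_of_localEquation_mem hf (exists_rep_ne_zero P).choose_spec ?_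
  by_cases h0 : localEquation f P.rep (exists_rep_ne_zero P).choose = 0
  · rw [h0]; exact zero_mem _
  · exact (le_orderAtOrigin_iff _ h0 m).mp h

/-- If no form of degree `e` vanishes on a set of points at which the curve `f = 0` of degree `D`
has multiplicity at least `m`, then products `q ^ m * c`, with `q` in a basis of forms of degree `e`
dual to points of the set and `c` a form of degree `m - 1`, are independent modulo `f`; counting
dimensions bounds `e`. -/
theorem mul_lt_of_forall_eq_zero {f : MvPolynomial (Fin 3) F} {D m e : ℕ}
    (hD : 0 < D) (hf0 : f ≠ 0) (hf : f.IsHomogeneous D) (S : Set (ℙ F (Fin 3 → F)))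
    (hS : ∀ P ∈ S, f ∈ pointIdeal P.rep ^ (m + 1))
    (h : ∀ g : MvPolynomial (Fin 3) F, g.IsHomogeneous e → (∀ P ∈ S, eval P.rep g = 0) → g = 0) :
    (m + 1) * (e + 1) < 4 * D := by
  by_contra hlt
  have hR := finrank_homogeneousSubmodule F
  obtain ⟨r, hr⟩ : ∃ r, Module.finrank F (homogeneousSubmodule (Fin 3) F e) = r := ⟨_, rfl⟩
  obtain ⟨s, q, hq⟩ := exists_dual_family (K := F) (V := homogeneousSubmodule (Fin 3) F e) hr
    (fun P : S => (aeval P.1.rep).toLinearMap.comp (homogeneousSubmodule (Fin 3) F e).subtype)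
    (fun x hx => Subtype.ext (h x.1 x.2 fun P hP => by simpa using hx ⟨P, hP⟩))
  replace hq : ∀ i j, eval (s i).1.rep (q j).1 = if i = j then 1 else 0 := by
    intro i j
    rw [← hq i j]
    simp
  -- `D + a` is the degree of the products `q ^ (m + 1) * c`, and `a` that of the cofactor of `f`.
  obtain ⟨a, ha⟩ : ∃ a, (m + 1) * e + m = D + a := by
    refine Nat.exists_eq_add_of_le ?_
    nlinarith
  let Φ : ((Fin r → homogeneousSubmodule (Fin 3) F m) × homogeneousSubmodule (Fin 3) F a) →ₗ[F]
      MvPolynomial (Fin 3) F :=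
    LinearMap.coprod
      (LinearMap.lsum F (fun _ => homogeneousSubmodule (Fin 3) F m) F fun i =>
        (LinearMap.mulLeft F ((q i).1 ^ (m + 1))).comp (Submodule.subtype _))
      ((LinearMap.mulLeft F f).comp (Submodule.subtype _))
  have hΦ : ∀ x, Φ x = ∑ i, (q i).1 ^ (m + 1) * (x.1 i).1 + f * x.2.1 := by
    intro x
    simp [Φ, LinearMap.lsum_apply]
  have hinj : Function.Injective Φ := by
    rw [← LinearMap.ker_eq_bot, LinearMap.ker_eq_bot']
    intro x hx
    rw [hΦ] at hx
    have h1 : ∀ j, x.1 j = 0 := by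
      intro j
      -- At the point `s j` every other `q i` vanishes and `f` has order at least `m + 1`.
      have hmem : (q j).1 ^ (m + 1) * (x.1 j).1 ∈ pointIdeal (s j).1.rep ^ (m + 1) := by
        rw [← Finset.add_sum_erase _ _ (Finset.mem_univ j)] at hx
        have : (q j).1 ^ (m + 1) * (x.1 j).1
            = -(∑ i ∈ Finset.univ.erase j, (q i).1 ^ (m + 1) * (x.1 i).1 + f * x.2.1) := by
          linear_combination hx
        rw [this]
        refine neg_mem (add_mem (Ideal.sum_mem _ fun i hi => Ideal.mul_mem_right _ _
          (Ideal.pow_mem_pow ?_ _)) (Ideal.mul_mem_right _ _ (hS _ (s j).2)))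
        refine mem_pointIdeal_of_eval_eq_zero (q i).2 (s j).1.rep_nonzero ?_
        rw [hq, if_neg (Finset.ne_of_mem_erase hi).symm]
      refine Subtype.ext (eq_zero_of_mem_pow_pointIdeal (x.1 j).2 m.lt_succ_self
        (mem_pow_pointIdeal_of_mul_mem (x.1 j).2 ((q j).2.pow (m + 1)) (s j).1.rep_nonzero ?_ hmem))
      simp [hq]
    simp only [h1, ZeroMemClass.coe_zero, mul_zero, Finset.sum_const_zero, zero_add, mul_eq_zero,
      hf0, false_or] at hx
    exact Prod.ext (funext h1) (Subtype.ext hx)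
  have hrange : ∀ x, Φ x ∈ homogeneousSubmodule (Fin 3) F (D + a) := by
    intro x
    rw [hΦ]
    refine add_mem (sum_mem fun i _ => ?_) (hf.mul x.2.2)
    have := ((q i).2.pow (m + 1)).mul (x.1 i).2
    rwa [mul_comm e, ha] at this
  have hle := LinearMap.finrank_le_finrank_of_injective (f := Φ.codRestrict _ hrange)
    ((LinearMap.injective_codRestrict_iff hrange).mpr hinj)
  rw [Module.finrank_prod, Module.finrank_pi_fintype, Finset.sum_const, Finset.card_univ,
    Fintype.card_fin, smul_eq_mul] at hle
  have e1 := hR e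
  have e2 := hR m
  have e3 := hR a
  have e4 := hR (D + a)
  rw [hr] at e1
  generalize Module.finrank F (homogeneousSubmodule (Fin 3) F m) = r2 at *
  generalize Module.finrank F (homogeneousSubmodule (Fin 3) F a) = r3 at *
  generalize Module.finrank F (homogeneousSubmodule (Fin 3) F (D + a)) = r4 at *
  have k1 : 4 * (r * r2) = ((e + 1) * (e + 2)) * ((m + 1) * (m + 2)) := by
    rw [← e1, ← e2]; ring
  -- `T = (m + 1) * (e + 1)` is one more than the degree in which dimensions are compared
  obtain ⟨T, hT⟩ : ∃ T, T = (m + 1) * (e + 1) := ⟨_, rfl⟩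
  have ha' : T = D + a + 1 := by rw [hT, ← ha]; ring
  have k2 : ((e + 1) * (e + 2)) * ((m + 1) * (m + 2)) = T * (T + (m + 1) + (e + 1) + 1) := by
    rw [hT]; ring
  -- Four times the inequality `r * r2 + r3 ≤ r4`; the difference of the two triangular numbers is
  -- `D * (2 * a + D + 3)`.
  have k3 : T * (T + (m + 1) + (e + 1) + 1) ≤ 2 * (D * (2 * a + D + 3)) := by nlinarith
  -- Uses `D ≥ 1`.
  have k4 : D * (2 * a + D + 3) ≤ 2 * D * T := by rw [ha']; nlinarith
  have k5 : 4 * D * T ≤ T * T := Nat.mul_le_mul_right T (by rw [hT]; omega)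
  have k6 : 0 < T := by omega
  nlinarith

end PlaneCurve

/-! ### Choice of the degree -/

theorem proposition2p1 :
    ∃ N : ℝ, ∀ (F : Type*) [Field F] (f : MvPolynomial (Fin 3) F) (D : ℕ),
      0 < D → f ≠ 0 → f.IsHomogeneous D →
      ∀ k : ℝ, 1 ≤ k →
        ∃ (g : MvPolynomial (Fin 3) F) (e : ℕ),
          0 < e ∧ g ≠ 0 ∧ g.IsHomogeneous e ∧ (e : ℝ) ≤ N * k ∧
          ∀ P ∈ PlaneCurve.points f,
            (D : ℝ) / k ≤ (PlaneCurve.multiplicity f P : ℝ) → P ∈ PlaneCurve.points g := by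
  refine ⟨4, fun F _ f D hD hf0 hf k hk => ?_⟩
  have hk0 : 0 < k := by linarith
  have hDk : 0 < (D : ℝ) / k := by positivity
  obtain ⟨m, hm⟩ := Nat.exists_eq_succ_of_ne_zero (Nat.ceil_pos.mpr hDk).ne'
  -- With `e + 1 = ⌈4 * k⌉₊`, the hypothesis `1 ≤ k` makes `e` positive, and `e < 4 * k` gives `N =
  -- 4`.
  have h4 : 4 ≤ ⌈4 * k⌉₊ := by
    have : (4 : ℝ) ≤ ⌈4 * k⌉₊ := le_trans (by linarith) (Nat.le_ceil _)
    exact_mod_cast this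
  obtain ⟨e, he⟩ : ∃ e, ⌈4 * k⌉₊ = e + 1 := ⟨⌈4 * k⌉₊ - 1, by omega⟩
  by_contra! hcon
  have hlt : (m + 1) * (e + 1) < 4 * D := by
    refine PlaneCurve.mul_lt_of_forall_eq_zero hD hf0 hf
      {P | P ∈ PlaneCurve.points f ∧ (D : ℝ) / k ≤ PlaneCurve.multiplicity f P}
      (fun P hP => PlaneCurve.mem_pow_pointIdeal_of_le_multiplicity hf ?_) fun g hg hgS => ?_
    · rw [← Nat.succ_eq_add_one, ← hm]
      exact Nat.ceil_le.mpr hP.2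
    · by_contra hg0
      have hek : (e : ℝ) ≤ 4 * k := by
        have := Nat.ceil_lt_add_one (a := 4 * k) (by positivity)
        rw [he] at this
        push_cast at this
        linarith
      obtain ⟨P, hP1, hP2, hP3⟩ := hcon g e (by omega) hg0 hg hek
      exact hP3 (hgS P ⟨hP1, hP2⟩)
  have h1 : (D : ℝ) / k ≤ (m + 1 : ℕ) := by
    rw [← Nat.succ_eq_add_one, ← hm]; exact Nat.le_ceil _
  have h2 : 4 * k ≤ (e + 1 : ℕ) := by rw [← he]; exact Nat.le_ceil _
  have h3 : (D : ℝ) / k * (4 * k) ≤ (m + 1 : ℕ) * (e + 1 : ℕ) :=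
    mul_le_mul h1 h2 (by positivity) (by positivity)
  have h5 : (D : ℝ) / k * (4 * k) = 4 * D := by field_simp
  rw [h5] at h3
  have h6 : 4 * D ≤ (m + 1) * (e + 1) := by exact_mod_cast h3
  omega
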